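/- Let $R$ be a noetherian commutative ring with $1$, let $n\ge 0$, and let $R[[t]][x]=R[[t]][x_1,\dots,x_n]$. Let $I\subseteq R[[t]][x]$ be an $x$-homogeneous ideal, i.e. an ideal generated by elements each of which is homogeneous as a polynomial in $x_1,\dots,x_n$ over $R[[t]]$. For $w=(w_0,\dots,w_n)\in\mathbb{R}_{<0}\times\mathbb{R}^n$ and $f=\sum_{\beta,\alpha}c_{\beta,\alpha}t^\beta x^\alpha\in R[[t]][x]$ let $\mathrm{in}_w(f)\in R[t,x]$ be the (finite) sum of those terms $c_{\beta,\alpha}t^\beta x^\alpha$ with $c_{\beta,\alpha}\neq 0$ for which $w\cdot(\beta,\alpha)$ is maximal among the terms occurring in $f$, with $\mathrm{in}_w(0)=0$, and let $$\mathrm{in}_w(I)=\langle \mathrm{in}_w(f)\mid f\in I\rangle\subseteq R[t,x]$$ be the initial ideal of $I$ with respect to $w$. Let $$C_w(I)=\overline{\{v\in\mathbb{R}_{<0}\times\mathbb{R}^n\mid \mathrm{in}_v(I)=\mathrm{in}_w(I)\}}\subseteq\mathbb{R}\times\mathbb{R}^n$$ (closure in the Euclidean topology) and $C_w^0(I)=C_w(I)\cap(\{0\}\times\mathbb{R}^n)$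 be the interior and boundary Gröbner cones of $I$. Then the set $\{\mathrm{in}_w(I)\mid w\in\mathbb{R}_{<0}\times\mathbb{R}^n\}$ of initial ideals of $I$ is finite. Consequently, $I$ has only finitely many Gröbner cones, i.e. the set $$\Sigma(I)=\{C_w(I)\mid w\in\mathbb{R}_{<0}\times\mathbb{R}^n\}\cup\{C_w^0(I)\mid w\in\mathbb{R}_{<0}\times\mathbb{R}^n\}$$ is finite. -/

import Mathlib

noncomputable section

namespace GroebnerFan

/-- The mixed power series polynomial ring `R⟦t⟧[x₁,…,xₙ]`. -/
abbrev MixedRing (R : Type*) [CommRing R] (n : ℕ) : Type _ :=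
  MvPolynomial (Fin n) (PowerSeries R)

/-- The polynomial ring `R[t,x₁,…,xₙ]`; the variable with index `0` is `t`, the variable with
index `i.succ` is the one that corresponds to index `i` in `MixedRing R n`. -/
abbrev PolyRing (R : Type*) [CommRing R] (n : ℕ) : Type _ :=
  MvPolynomial (Fin (n + 1)) R

variable {R : Type*} [CommRing R] {n : ℕ}

/-- The coefficient in `f` of the monomial `t^β x^α`, where `m = (β, α)`, i.e. `β = m 0` and
`α = m.tail`. -/
def mixedCoeff (f : MixedRing R n) (m : Fin (n + 1) →₀ ℕ) : R :=
  PowerSeries.coeff (m 0) (MvPolynomial.coeff m.tail f)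

/-- An ideal of `R⟦t⟧[x]` is `x`-homogeneous if it is generated by elements which are homogeneous
in the variables `x`. -/
def IsXHomogeneous (I : Ideal (MixedRing R n)) : Prop :=
  ∃ S : Set (MixedRing R n), (∀ f ∈ S, ∃ d : ℕ, f.IsHomogeneous d) ∧ I = Ideal.span S

/-- The scalar product `w · m` of a weight vector and an exponent vector. -/
def weightDeg (w : Fin (n + 1) → ℝ) (m : Fin (n + 1) →₀ ℕ) : ℝ :=
  ∑ i, w i * (m i : ℝ)

/-- The exponents `(β, α)` of the monomials occurring in `f` for which `w · (β, α)` is maximal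
among all the monomials occurring in `f`. -/
def initialExponents (w : Fin (n + 1) → ℝ) (f : MixedRing R n) : Set (Fin (n + 1) →₀ ℕ) :=
  {m | mixedCoeff f m ≠ 0 ∧ ∀ m', mixedCoeff f m' ≠ 0 → weightDeg w m' ≤ weightDeg w m}

/-- The initial form of `f` with respect to a weight vector `w` with `w 0 < 0`: the sum of the
terms of `f` of maximal weight. The sum is finite by `initialExponents_finite`. -/
def initialForm (w : Fin (n + 1) → ℝ) (f : MixedRing R n) : PolyRing R n :=
  ∑ᶠ m ∈ initialExponents w f, MvPolynomial.monomial m (mixedCoeff f m)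

theorem initialExponents_finite (w : Fin (n + 1) → ℝ) (hw : w 0 < 0) (f : MixedRing R n) :
    (initialExponents w f).Finite := by
  refine Set.Finite.of_injOn (f := Finsupp.tail) (t := (f.support : Set (Fin n →₀ ℕ))) ?_ ?_
    (Finset.finite_toSet _)
  · intro m hm
    rw [Finset.mem_coe, MvPolynomial.mem_support_iff]
    intro h
    exact hm.1 (by simp [mixedCoeff, h])
  · intro m hm m' hm' h
    have h1 : weightDeg w m = weightDeg w m' := le_antisymm (hm'.2 m hm.1) (hm.2 m' hm'.1)
    have h2 : ∀ i : Fin n, m i.succ = m' i.succ := fun i => by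
      rw [← Finsupp.tail_apply, ← Finsupp.tail_apply, h]
    simp only [weightDeg, Fin.sum_univ_succ, h2, add_left_inj] at h1
    have h3 : m 0 = m' 0 := by exact_mod_cast mul_left_cancel₀ hw.ne h1
    ext i
    exact Fin.cases h3 h2 i

open Classical in
theorem coeff_initialForm (w : Fin (n + 1) → ℝ) (hw : w 0 < 0) (f : MixedRing R n)
    (m : Fin (n + 1) →₀ ℕ) :
    MvPolynomial.coeff m (initialForm w f) =
      if m ∈ initialExponents w f then mixedCoeff f m else 0 := by
  rw [initialForm, finsum_mem_eq_finite_toFinset_sum _ (initialExponents_finite w hw f),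
    MvPolynomial.coeff_sum]
  simp [MvPolynomial.coeff_monomial]

/-- The initial ideal of `I` with respect to the weight vector `w`. -/
def initialIdeal (w : Fin (n + 1) → ℝ) (I : Ideal (MixedRing R n)) : Ideal (PolyRing R n) :=
  Ideal.span (initialForm w '' (I : Set (MixedRing R n)))

/-- The interior Gröbner cone `C_w(I)`: the closure in `ℝ × ℝⁿ` of the set of all
`v ∈ ℝ_{<0} × ℝⁿ` with the same initial ideal as `w`. -/
def interiorCone (I : Ideal (MixedRing R n)) (w : Fin (n + 1) → ℝ) : Set (Fin (n + 1) → ℝ) :=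
  closure {v | v 0 < 0 ∧ initialIdeal v I = initialIdeal w I}

/-- The boundary Gröbner cone `C_w^0(I)`. -/
def boundaryCone (I : Ideal (MixedRing R n)) (w : Fin (n + 1) → ℝ) : Set (Fin (n + 1) → ℝ) :=
  interiorCone I w ∩ {v | v 0 = 0}

/-- The Gröbner fan of `I`: the collection of all its Gröbner cones. -/
def groebnerFan (I : Ideal (MixedRing R n)) : Set (Set (Fin (n + 1) → ℝ)) :=
  {C | ∃ w : Fin (n + 1) → ℝ, w 0 < 0 ∧ C = interiorCone I w} ∪
    {C | ∃ w : Fin (n + 1) → ℝ, w 0 < 0 ∧ C = boundaryCone I w}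

end GroebnerFan

end

noncomputable section

namespace GroebnerFan

variable {R : Type*} [CommRing R] {n : ℕ}

/-! The proof is a Noetherian induction on ideals of leading terms. Take finitely many x-forms `g i`
in I with chosen exponents `e i`, let J ⊆ R[t,x] be generated by the terms of the `g i` at `e i`,
and consider only weights for which every `e i` leads `g i`, ties being broken lexicographically. If
for all these weights J contains the leading terms of all x-forms in I, then in_w(I) is generated by
the in_w(g i), and each `g i` has only finitely many initial forms. Otherwise some x-form f in I
violates this for one weight, and its remainder r on division by the `g i` is a nonzero x-form none
of whose terms lies in J. That property of r no longer refers to the weight: for any other weight,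
whichever of finitely many candidates leads r, adjoining its term enlarges J strictly.

Division works despite power series in t: as w 0 < 0, only finitely many monomials of given x-degree
lie above a given one, so coefficients can be defined by recursion from above. The main lemmas are
`exists_division`, `initialIdeal_eq_span` and `finite_initialIdeals_of_isLeading`. -/

/-- The total degree in the variables `x` of the monomial `t^β x^α`. -/
def xDegree (m : Fin (n + 1) →₀ ℕ) : ℕ := m.tail.degree

/-- The comparison key of a monomial for the weight order refined by the lexicographic order. -/
def orderKey (w : Fin (n + 1) → ℝ) (m : Fin (n + 1) →₀ ℕ) : ℝ ×ₗ Lex (Fin (n + 1) →₀ ℕ) :=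
  toLex (weightDeg w m, toLex m)

/-- All monomials occurring in `f` have degree `d` in the variables `x`. -/
def IsXForm (d : ℕ) (f : MixedRing R n) : Prop :=
  ∀ m, mixedCoeff f m ≠ 0 → xDegree m = d

/-- The monomial with exponent `e` is the leading monomial of `f` for the order refining `w`. -/
def IsLeading (w : Fin (n + 1) → ℝ) (f : MixedRing R n) (e : Fin (n + 1) →₀ ℕ) : Prop :=
  mixedCoeff f e ≠ 0 ∧ ∀ m, mixedCoeff f m ≠ 0 → orderKey w m ≤ orderKey w e

/-! ### Arithmetic of exponents, order keys and coefficients -/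

theorem weightDeg_add (w : Fin (n + 1) → ℝ) (a b : Fin (n + 1) →₀ ℕ) :
    weightDeg w (a + b) = weightDeg w a + weightDeg w b := by
  simp [weightDeg, mul_add, Finset.sum_add_distrib]

theorem xDegree_add (a b : Fin (n + 1) →₀ ℕ) : xDegree (a + b) = xDegree a + xDegree b := by
  have h : (a + b).tail = a.tail + b.tail := by
    ext i
    simp [Finsupp.tail_apply]
  simp [xDegree, h]

theorem orderKey_add (w : Fin (n + 1) → ℝ) (a b : Fin (n + 1) →₀ ℕ) :
    orderKey w (a + b) = orderKey w a + orderKey w b := by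
  rw [orderKey, weightDeg_add]
  rfl

theorem orderKey_injective (w : Fin (n + 1) → ℝ) : Function.Injective (orderKey w) := by
  intro a b h
  have h1 := congrArg (fun x => ofLex (ofLex x).2) h
  exact h1

theorem weightDeg_le_of_orderKey_le {w : Fin (n + 1) → ℝ} {a b : Fin (n + 1) →₀ ℕ}
    (h : orderKey w a ≤ orderKey w b) : weightDeg w a ≤ weightDeg w b := by
  rcases Prod.Lex.le_iff.1 h with h | h
  · exact h.le
  · exact h.1.le

theorem mixedCoeff_sub (f g : MixedRing R n) (m : Fin (n + 1) →₀ ℕ) :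
    mixedCoeff (f - g) m = mixedCoeff f m - mixedCoeff g m := by
  simp [mixedCoeff]

theorem mixedCoeff_sum {ι : Type*} (s : Finset ι) (f : ι → MixedRing R n)
    (m : Fin (n + 1) →₀ ℕ) :
    mixedCoeff (∑ i ∈ s, f i) m = ∑ i ∈ s, mixedCoeff (f i) m := by
  simp [mixedCoeff, MvPolynomial.coeff_sum]

theorem mixedCoeff_mul (f g : MixedRing R n) (m : Fin (n + 1) →₀ ℕ) :
    mixedCoeff (f * g) m =
      ∑ p ∈ Finset.HasAntidiagonal.antidiagonal m, mixedCoeff f p.1 * mixedCoeff g p.2 := by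
  simp only [mixedCoeff, MvPolynomial.coeff_mul, map_sum, PowerSeries.coeff_mul]
  rw [← Finset.sum_product']
  refine (Finset.sum_bij'
    (fun (p : (Fin (n + 1) →₀ ℕ) × (Fin (n + 1) →₀ ℕ)) _ => ((p.1.tail, p.2.tail), (p.1 0, p.2 0)))
    (fun q _ => (Finsupp.cons q.2.1 q.1.1, Finsupp.cons q.2.2 q.1.2)) ?_ ?_ ?_ ?_ ?_).symm
  · intro p hp
    obtain rfl := Finset.HasAntidiagonal.mem_antidiagonal.1 hp
    simp only [Finset.mem_product, Finset.HasAntidiagonal.mem_antidiagonal]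
    refine ⟨?_, rfl⟩
    ext i
    simp [Finsupp.tail_apply]
  · intro q hq
    simp only [Finset.mem_product, Finset.HasAntidiagonal.mem_antidiagonal] at hq ⊢
    ext i
    refine Fin.cases ?_ (fun j => ?_) i
    · simpa using hq.2
    · simpa [Finsupp.tail_apply] using DFunLike.congr_fun hq.1 j
  · intro p _
    simp [Finsupp.cons_tail]
  · intro q _
    simp
  · intro p _
    rfl

theorem finite_xDegree_le (d : ℕ) : {α : Fin n →₀ ℕ | α.degree ≤ d}.Finite :=
  Finsupp.finite_of_degree_le d

theorem exists_mixedCoeff_eq (c : (Fin (n + 1) →₀ ℕ) → R) (d : ℕ)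
    (hc : ∀ m, c m ≠ 0 → xDegree m ≤ d) : ∃ q : MixedRing R n, ∀ m, mixedCoeff q m = c m := by
  classical
  refine ⟨∑ α ∈ (finite_xDegree_le (n := n) d).toFinset,
    MvPolynomial.monomial α (PowerSeries.mk fun b => c (Finsupp.cons b α)), fun m => ?_⟩
  simp only [mixedCoeff, MvPolynomial.coeff_sum, MvPolynomial.coeff_monomial,
    Finset.sum_ite_eq', Set.Finite.mem_toFinset, Set.mem_ofPred_eq]
  split_ifs with h
  · rw [PowerSeries.coeff_mk, Finsupp.cons_tail]
  · by_contra h'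
    exact h (hc m (by simpa [eq_comm] using h'))

/-- The part of weight `c` of `q`, as a polynomial. -/
theorem exists_weightPart {w : Fin (n + 1) → ℝ} (hw : w 0 < 0) (c : ℝ) (q : MixedRing R n) :
    ∃ P : PolyRing R n, (∀ m, weightDeg w m = c → MvPolynomial.coeff m P = mixedCoeff q m) ∧
      ∀ m, weightDeg w m ≠ c → MvPolynomial.coeff m P = 0 := by
  classical
  -- Since w 0 ≠ 0, the weight and the x-exponent together determine the t-exponent.
  have hfin : {m | weightDeg w m = c ∧ mixedCoeff q m ≠ 0}.Finite := by
    refine Set.Finite.of_injOn (f := Finsupp.tail) (t := (q.support : Set (Fin n →₀ ℕ))) ?_ ?_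
      (Finset.finite_toSet _)
    · intro m hm
      rw [Finset.mem_coe, MvPolynomial.mem_support_iff]
      intro h
      exact hm.2 (by simp [mixedCoeff, h])
    · intro m hm m' hm' h
      have h1 : weightDeg w m = weightDeg w m' := hm.1.trans hm'.1.symm
      have h2 : ∀ i : Fin n, m i.succ = m' i.succ := fun i => by
        rw [← Finsupp.tail_apply, ← Finsupp.tail_apply, h]
      simp only [weightDeg, Fin.sum_univ_succ, h2, add_left_inj] at h1
      have h3 : m 0 = m' 0 := by exact_mod_cast mul_left_cancel₀ hw.ne h1
      ext i
      exact Fin.cases h3 h2 i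
  refine ⟨∑ m ∈ hfin.toFinset, MvPolynomial.monomial m (mixedCoeff q m), ?_, ?_⟩
  · intro m hm
    simp only [MvPolynomial.coeff_sum, MvPolynomial.coeff_monomial, Finset.sum_ite_eq',
      Set.Finite.mem_toFinset, Set.mem_ofPred_eq]
    split_ifs with h
    · rfl
    · by_contra h'
      exact h ⟨hm, fun h0 => h' h0.symm⟩
  · intro m hm
    simp [MvPolynomial.coeff_sum, MvPolynomial.coeff_monomial, hm]

/-! ### Leading monomials and well-foundedness in fixed x-degree -/

theorem finite_le_weightDeg {w : Fin (n + 1) → ℝ} (hw : w 0 < 0) (d : ℕ) (c : ℝ) :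
    {m : Fin (n + 1) →₀ ℕ | xDegree m = d ∧ c ≤ weightDeg w m}.Finite := by
  obtain ⟨B, hB⟩ : ∃ B : ℝ, ∀ α : Fin n →₀ ℕ, α.degree ≤ d →
      ∑ i : Fin n, w i.succ * (α i : ℝ) ≤ B := by
    obtain ⟨B, hB⟩ := ((finite_xDegree_le (n := n) d).image
      fun α => ∑ i : Fin n, w i.succ * (α i : ℝ)).bddAbove
    exact ⟨B, fun α hα => hB ⟨α, hα, rfl⟩⟩
  -- B bounds the x-part of the weight, so w 0 * β + B ≥ c bounds β, the sign of w 0 being negative.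
  obtain ⟨N, hN⟩ := exists_nat_ge ((B - c) / (-w 0))
  refine Set.Finite.subset (((Set.finite_Iic N).prod (finite_xDegree_le (n := n) d)).image
    fun p => Finsupp.cons p.1 p.2) ?_
  rintro m ⟨hm, hmc⟩
  refine ⟨(m 0, m.tail), ⟨?_, hm.le⟩, Finsupp.cons_tail m⟩
  have h1 := hB m.tail hm.le
  simp only [weightDeg, Fin.sum_univ_succ] at hmc
  simp only [Finsupp.tail_apply] at h1
  have h2 : (m 0 : ℝ) ≤ (B - c) / (-w 0) := by
    rw [le_div_iff₀ (by linarith)]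
    linarith
  exact_mod_cast h2.trans hN

theorem exists_isLeading {w : Fin (n + 1) → ℝ} (hw : w 0 < 0) {d : ℕ} {f : MixedRing R n}
    (hf : IsXForm d f) {m₀ : Fin (n + 1) →₀ ℕ} (hm₀ : mixedCoeff f m₀ ≠ 0) :
    ∃ e, IsLeading w f e := by
  have hfin : {m | mixedCoeff f m ≠ 0 ∧ orderKey w m₀ ≤ orderKey w m}.Finite :=
    (finite_le_weightDeg hw d (weightDeg w m₀)).subset fun m hm =>
      ⟨hf m hm.1, weightDeg_le_of_orderKey_le hm.2⟩
  obtain ⟨e, he, hmax⟩ := Set.exists_max_image _ (orderKey w) hfin ⟨m₀, hm₀, le_rfl⟩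
  refine ⟨e, he.1, fun m hm => ?_⟩
  rcases le_total (orderKey w m₀) (orderKey w m) with h | h
  · exact hmax m ⟨hm, h⟩
  · exact h.trans he.2

/-- `m'` is larger than `m` and has the same degree in `x`. -/
def IsAbove (w : Fin (n + 1) → ℝ) (m' m : Fin (n + 1) →₀ ℕ) : Prop :=
  orderKey w m < orderKey w m' ∧ xDegree m' = xDegree m

theorem wellFounded_isAbove {w : Fin (n + 1) → ℝ} (hw : w 0 < 0) : WellFounded (IsAbove w) := by
  -- The measure is the number of monomials above m; passing to a larger monomial decreases it
  -- strictly.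
  refine Subrelation.wf (r := InvImage (· < ·)
    fun m : Fin (n + 1) →₀ ℕ => {m' | IsAbove w m' m}.ncard) ?_ (InvImage.wf _ wellFounded_lt)
  intro a b hab
  have hss : {m' | IsAbove w m' a} ⊆ {m' | IsAbove w m' b} :=
    fun m hm => ⟨hab.1.trans hm.1, hm.2.trans hab.2⟩
  refine Set.ncard_lt_ncard ((Set.ssubset_iff_of_subset hss).2
    ⟨a, hab, fun h => lt_irrefl _ h.1⟩) ?_
  exact (finite_le_weightDeg hw (xDegree b) (weightDeg w b)).subset fun m hm =>
    ⟨hm.2, weightDeg_le_of_orderKey_le hm.1.le⟩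

/-! ### Division with remainder -/

theorem exists_reduction_coeff {ι : Type*} [Fintype ι] (e : ι → Fin (n + 1) →₀ ℕ) (c : ι → R)
    (m : Fin (n + 1) →₀ ℕ) (a : R)
    (h : MvPolynomial.monomial m a ∈
      Ideal.span (Set.range fun i => (MvPolynomial.monomial (e i) (c i) : PolyRing R n))) :
    ∃ b : ι → R, (∀ i, b i ≠ 0 → e i ≤ m) ∧ ∑ i, b i * c i = a := by
  classical
  obtain ⟨q, hq⟩ := Ideal.mem_span_range_iff_exists_fun.1 h
  refine ⟨fun i => if e i ≤ m then MvPolynomial.coeff (m - e i) (q i) else 0, ?_, ?_⟩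
  · intro i hi
    by_contra h'
    exact hi (if_neg h')
  · have := congrArg (MvPolynomial.coeff m) hq
    rw [MvPolynomial.coeff_monomial, if_pos rfl, MvPolynomial.coeff_sum] at this
    rw [← this]
    refine Finset.sum_congr rfl fun i _ => ?_
    rw [MvPolynomial.coeff_mul_monomial', ite_mul, zero_mul]

theorem monomial_sum_mul_mem {ι : Type*} [Fintype ι] (e : ι → Fin (n + 1) →₀ ℕ) (c : ι → R)
    (m : Fin (n + 1) →₀ ℕ) (b : ι → R) (hb : ∀ i, b i ≠ 0 → e i ≤ m) :
    MvPolynomial.monomial m (∑ i, b i * c i) ∈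
      Ideal.span (Set.range fun i => (MvPolynomial.monomial (e i) (c i) : PolyRing R n)) := by
  rw [map_sum]
  refine Ideal.sum_mem _ fun i _ => ?_
  by_cases h : b i = 0
  · simp [h]
  · have : MvPolynomial.monomial m (b i * c i) =
        MvPolynomial.monomial (m - e i) (b i) * MvPolynomial.monomial (e i) (c i) := by
      rw [MvPolynomial.monomial_mul, tsub_add_cancel_of_le (hb i h)]
    rw [this]
    exact Ideal.mul_mem_left _ _ (Ideal.subset_span ⟨i, rfl⟩)

/-- Over a ring no leading coefficient is inverted: a term in the monomial ideal is cancelled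
completely, any other is left alone with b = 0. Zero multipliers outside x-degree d keep the
quotients polynomial in x. -/
theorem exists_reduction {ι : Type*} [Fintype ι] (e : ι → Fin (n + 1) →₀ ℕ) (c : ι → R) (d : ℕ)
    (m : Fin (n + 1) →₀ ℕ) (a : R) :
    ∃ b : ι → R, (∀ i, b i ≠ 0 → e i ≤ m ∧ a ≠ 0 ∧ xDegree m = d) ∧
      (xDegree m = d → a - ∑ i, b i * c i ≠ 0 →
        MvPolynomial.monomial m (a - ∑ i, b i * c i) ∉
          Ideal.span (Set.range fun i => (MvPolynomial.monomial (e i) (c i) : PolyRing R n))) := by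
  by_cases h : (a ≠ 0 ∧ xDegree m = d) ∧ MvPolynomial.monomial m a ∈
      Ideal.span (Set.range fun i => (MvPolynomial.monomial (e i) (c i) : PolyRing R n))
  · obtain ⟨b, hb, hs⟩ := exists_reduction_coeff e c m a h.2
    exact ⟨b, fun i hi => ⟨hb i hi, h.1⟩, fun _ h' => absurd (sub_eq_zero.2 hs.symm) h'⟩
  · refine ⟨0, fun i hi => absurd rfl hi, fun hd ha hmem => ?_⟩
    simp only [Pi.zero_apply, zero_mul, Finset.sum_const_zero, sub_zero] at ha hmem
    exact h ⟨⟨ha, hd⟩, hmem⟩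

theorem isXForm_sub_sum_mul {ι : Type*} [Fintype ι] {d : ℕ} {k : ι → ℕ} {f : MixedRing R n}
    {q g : ι → MixedRing R n} (hf : IsXForm d f)
    (hq : ∀ i μ, mixedCoeff (q i) μ ≠ 0 → xDegree μ + k i = d) (hg : ∀ i, IsXForm (k i) (g i)) :
    IsXForm d (f - ∑ i, q i * g i) := by
  intro m hm
  by_contra hd
  apply hm
  rw [mixedCoeff_sub, mixedCoeff_sum, sub_eq_zero]
  rw [not_imp_comm.1 (hf m) hd, eq_comm]
  refine Finset.sum_eq_zero fun i _ => ?_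
  rw [mixedCoeff_mul]
  refine Finset.sum_eq_zero fun p hp => ?_
  by_contra h
  apply hd
  rw [← Finset.HasAntidiagonal.mem_antidiagonal.1 hp, xDegree_add,
    hg i p.2 (right_ne_zero_of_mul h), hq i p.1 (left_ne_zero_of_mul h)]

/-- Division with remainder of an `x`-form by finitely many `x`-forms with given leading
monomials. -/
theorem exists_division {ι : Type*} [Fintype ι] {w : Fin (n + 1) → ℝ} (hw : w 0 < 0)
    {g : ι → MixedRing R n} {e : ι → Fin (n + 1) →₀ ℕ} (hg : ∀ i, IsXForm (xDegree (e i)) (g i))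
    (hlead : ∀ i, IsLeading w (g i) (e i)) {d : ℕ} {f : MixedRing R n} (hf : IsXForm d f) :
    ∃ q : ι → MixedRing R n,
      (∀ i μ, mixedCoeff (q i) μ ≠ 0 →
        ∃ m, mixedCoeff f m ≠ 0 ∧ orderKey w (μ + e i) ≤ orderKey w m) ∧
      IsXForm d (f - ∑ i, q i * g i) ∧
      ∀ m, mixedCoeff (f - ∑ i, q i * g i) m ≠ 0 →
        MvPolynomial.monomial m (mixedCoeff (f - ∑ i, q i * g i) m) ∉
          Ideal.span (Set.range fun i =>
            (MvPolynomial.monomial (e i) (mixedCoeff (g i) (e i)) : PolyRing R n)) := by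
  classical
  choose C hC hCJ using exists_reduction e (fun i => mixedCoeff (g i) (e i)) d
  -- `a m` will be the coefficient left at m once all larger monomials have been reduced, before the
  -- reduction at m itself.
  let T : (m : Fin (n + 1) →₀ ℕ) → ((m' : Fin (n + 1) →₀ ℕ) → IsAbove w m' m → R) → R :=
    fun m a => mixedCoeff f m - ∑ i, ∑ p ∈ Finset.HasAntidiagonal.antidiagonal m,
      if h : IsAbove w (p.1 + e i) m then
        C (p.1 + e i) (a _ h) i * mixedCoeff (g i) p.2 else 0
  let a : (Fin (n + 1) →₀ ℕ) → R := (wellFounded_isAbove hw).fix T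
  have ha : ∀ m, a m = mixedCoeff f m - ∑ i, ∑ p ∈ Finset.HasAntidiagonal.antidiagonal m,
      if IsAbove w (p.1 + e i) m then
        C (p.1 + e i) (a (p.1 + e i)) i * mixedCoeff (g i) p.2 else 0 := by
    intro m
    exact (wellFounded_isAbove hw).fix_eq T m
  have hq : ∀ i, ∃ q : MixedRing R n, ∀ μ, mixedCoeff q μ = C (μ + e i) (a (μ + e i)) i := by
    intro i
    refine exists_mixedCoeff_eq _ d fun μ hμ => ?_
    have := (hC _ _ _ hμ).2.2
    rw [xDegree_add] at this
    omega
  choose q hq using hq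
  have hbound : ∀ m, a m ≠ 0 → ∃ m', mixedCoeff f m' ≠ 0 ∧ orderKey w m ≤ orderKey w m' := by
    intro m
    induction m using (wellFounded_isAbove hw).induction with
    | _ m ih =>
      intro hm
      by_cases hfm : mixedCoeff f m = 0
      · rw [ha, hfm, zero_sub, neg_ne_zero] at hm
        obtain ⟨i, _, hi⟩ := Finset.exists_ne_zero_of_sum_ne_zero hm
        obtain ⟨p, _, hp⟩ := Finset.exists_ne_zero_of_sum_ne_zero hi
        split_ifs at hp with h
        · obtain ⟨m', hm', hle⟩ := ih _ h (hC _ _ _ (left_ne_zero_of_mul hp)).2.1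
          exact ⟨m', hm', h.1.le.trans hle⟩
        · exact absurd rfl hp
      · exact ⟨m, hfm, le_rfl⟩
  have hform : IsXForm d (f - ∑ i, q i * g i) := by
    refine isXForm_sub_sum_mul hf (fun i μ hμ => ?_) hg
    rw [hq] at hμ
    rw [← xDegree_add]
    exact (hC _ _ _ hμ).2.2
  have hcoeff : ∀ m, mixedCoeff (f - ∑ i, q i * g i) m =
      a m - ∑ i, C m (a m) i * mixedCoeff (g i) (e i) := by
    intro m
    rw [mixedCoeff_sub, mixedCoeff_sum, ha m, sub_sub, ← Finset.sum_add_distrib, ← ha m]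
    congr 1
    refine Finset.sum_congr rfl fun i _ => ?_
    rw [mixedCoeff_mul]
    -- The reduction at m enters only through the pair (m - e i, e i); all other nonzero
    -- contributions come from monomials above m and are already in `a m`.
    have hsplit : C m (a m) i * mixedCoeff (g i) (e i) =
        ∑ p ∈ Finset.HasAntidiagonal.antidiagonal m,
          if p.1 + e i = m then C m (a m) i * mixedCoeff (g i) (e i) else 0 := by
      by_cases h : C m (a m) i = 0
      · simp [h]
      · have hle := (hC _ _ _ h).1
        rw [Finset.sum_eq_single (m - e i, e i)]
        · rw [if_pos (tsub_add_cancel_of_le hle)]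
        · intro p hp hne
          refine if_neg fun hpe => hne ?_
          have h1 := Finset.HasAntidiagonal.mem_antidiagonal.1 hp
          have h2 : p.2 = e i := add_left_cancel (h1.trans hpe.symm)
          exact Prod.ext (by rw [← hpe, add_tsub_cancel_right]) h2
        · intro h'
          exact absurd (Finset.HasAntidiagonal.mem_antidiagonal.2 (tsub_add_cancel_of_le hle)) h'
    rw [hsplit, ← Finset.sum_add_distrib]
    refine Finset.sum_congr rfl fun p hp => ?_
    have hpm := Finset.HasAntidiagonal.mem_antidiagonal.1 hp
    rw [hq]
    by_cases hpe : p.1 + e i = m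
    · have h2 : p.2 = e i := add_left_cancel (hpm.trans hpe.symm)
      rw [if_neg (fun h => (lt_irrefl _ (hpe ▸ h.1))), if_pos hpe, hpe, h2, zero_add]
    · rw [if_neg hpe, add_zero]
      by_cases hgp : mixedCoeff (g i) p.2 = 0
      · simp [hgp]
      · rw [if_pos]
        refine ⟨lt_of_le_of_ne ?_ fun h => hpe (orderKey_injective w h).symm, ?_⟩
        · rw [← hpm, orderKey_add, orderKey_add]
          exact add_le_add_right ((hlead i).2 _ hgp) _
        · rw [← hpm, xDegree_add, xDegree_add, hg i _ hgp]
  refine ⟨q, fun i μ hμ => ?_, hform, fun m hm => ?_⟩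
  · rw [hq] at hμ
    exact hbound _ (hC _ _ _ hμ).2.1
  · have hd := hform m hm
    rw [hcoeff] at hm ⊢
    exact hCJ _ _ hd hm

/-- If an `x`-form has a standard representation, its leading term lies in the ideal of the leading
terms. -/
theorem leadingTerm_mem {ι : Type*} [Fintype ι] {w : Fin (n + 1) → ℝ}
    {g : ι → MixedRing R n} {e : ι → Fin (n + 1) →₀ ℕ}
    (hlead : ∀ i, IsLeading w (g i) (e i)) {f : MixedRing R n} {m : Fin (n + 1) →₀ ℕ}
    (hm : IsLeading w f m) {q : ι → MixedRing R n} (hf : f = ∑ i, q i * g i)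
    (hq : ∀ i μ, mixedCoeff (q i) μ ≠ 0 →
      ∃ m, mixedCoeff f m ≠ 0 ∧ orderKey w (μ + e i) ≤ orderKey w m) :
    MvPolynomial.monomial m (mixedCoeff f m) ∈ Ideal.span (Set.range fun i =>
      (MvPolynomial.monomial (e i) (mixedCoeff (g i) (e i)) : PolyRing R n)) := by
  classical
  have hkey : ∀ i μ, mixedCoeff (q i) μ ≠ 0 → orderKey w (μ + e i) ≤ orderKey w m := by
    intro i μ hμ
    obtain ⟨m', hm', hle⟩ := hq i μ hμ
    exact hle.trans (hm.2 m' hm')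
  have hcoeff : mixedCoeff f m =
      ∑ i, (if e i ≤ m then mixedCoeff (q i) (m - e i) else 0) * mixedCoeff (g i) (e i) := by
    conv_lhs => rw [hf, mixedCoeff_sum]
    refine Finset.sum_congr rfl fun i _ => ?_
    rw [mixedCoeff_mul]
    -- A product not using the leading term of `g i` has key strictly below that of m.
    have hzero : ∀ p ∈ Finset.HasAntidiagonal.antidiagonal m, p.2 ≠ e i →
        mixedCoeff (q i) p.1 * mixedCoeff (g i) p.2 = 0 := by
      intro p hp hne
      by_contra h
      have h1 := hkey i _ (left_ne_zero_of_mul h)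
      have h2 := (hlead i).2 _ (right_ne_zero_of_mul h)
      have h3 := lt_of_le_of_ne h2 fun h => hne (orderKey_injective w h)
      rw [← Finset.HasAntidiagonal.mem_antidiagonal.1 hp, orderKey_add, orderKey_add] at h1
      exact absurd h1 (not_le.2 (add_lt_add_right h3 _))
    split_ifs with h
    · rw [Finset.sum_eq_single (m - e i, e i)]
      · intro p hp hne
        refine hzero p hp fun hpe => hne (Prod.ext ?_ hpe)
        rw [← Finset.HasAntidiagonal.mem_antidiagonal.1 hp, hpe, add_tsub_cancel_right]
      · intro h'
        exact absurd (Finset.HasAntidiagonal.mem_antidiagonal.2 (tsub_add_cancel_of_le h)) h'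
    · rw [zero_mul]
      refine Finset.sum_eq_zero fun p hp => hzero p hp fun hpe => h ?_
      rw [← Finset.HasAntidiagonal.mem_antidiagonal.1 hp, hpe]
      exact le_add_self
  rw [hcoeff]
  refine monomial_sum_mul_mem e _ m _ fun i hi => ?_
  by_contra h
  exact hi (if_neg h)

/-! ### Generators of the initial ideal -/

theorem coeff_initialForm_of_isLeading {w : Fin (n + 1) → ℝ} (hw : w 0 < 0) {g : MixedRing R n}
    {e : Fin (n + 1) →₀ ℕ} (he : IsLeading w g e) (m : Fin (n + 1) →₀ ℕ) :
    MvPolynomial.coeff m (initialForm w g) =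
      if weightDeg w m = weightDeg w e then mixedCoeff g m else 0 := by
  classical
  have hle : ∀ m', mixedCoeff g m' ≠ 0 → weightDeg w m' ≤ weightDeg w e :=
    fun m' h => weightDeg_le_of_orderKey_le (he.2 m' h)
  rw [coeff_initialForm w hw]
  split_ifs with h1 h2 h2
  · rfl
  · exact absurd (le_antisymm (hle m h1.1) (h1.2 e he.1)) h2
  · by_contra h0
    exact h1 ⟨fun h => h0 h.symm, fun m' hm' => h2 ▸ hle m' hm'⟩
  · rfl

/-- The part of maximal weight of an element with a standard representation lies in the ideal
generated by the initial forms. -/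
theorem weightPart_mem {ι : Type*} [Fintype ι] {w : Fin (n + 1) → ℝ} (hw : w 0 < 0)
    {g q : ι → MixedRing R n} {e : ι → Fin (n + 1) →₀ ℕ} (hlead : ∀ i, IsLeading w (g i) (e i))
    {f : MixedRing R n} (hf : f = ∑ i, q i * g i) {c : ℝ}
    (hq : ∀ i μ, mixedCoeff (q i) μ ≠ 0 → weightDeg w (μ + e i) ≤ c) {P : PolyRing R n}
    (hP : ∀ m, weightDeg w m = c → MvPolynomial.coeff m P = mixedCoeff f m)
    (hP' : ∀ m, weightDeg w m ≠ c → MvPolynomial.coeff m P = 0) :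
    P ∈ Ideal.span (Set.range fun i => initialForm w (g i)) := by
  classical
  -- Every term of `q i * g i` has weight at most c, with equality only for this part of `q i` times
  -- the initial form of `g i`.
  choose Q hQ hQ' using fun i => exists_weightPart hw (c - weightDeg w (e i)) (q i)
  refine Ideal.mem_span_range_iff_exists_fun.2 ⟨Q, ?_⟩
  ext m
  rw [MvPolynomial.coeff_sum]
  simp only [MvPolynomial.coeff_mul, coeff_initialForm_of_isLeading hw (hlead _)]
  by_cases hm : weightDeg w m = c
  · rw [hP m hm, hf, mixedCoeff_sum]
    refine Finset.sum_congr rfl fun i _ => ?_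
    rw [mixedCoeff_mul]
    refine Finset.sum_congr rfl fun p hp => ?_
    have hpm : weightDeg w p.1 + weightDeg w p.2 = c := by
      rw [← weightDeg_add, Finset.HasAntidiagonal.mem_antidiagonal.1 hp, hm]
    split_ifs with h
    · rw [hQ i _ (by linarith)]
    · rw [mul_zero]
      by_contra h0
      have h1 := hq i _ (left_ne_zero_of_mul (Ne.symm h0))
      have h2 := weightDeg_le_of_orderKey_le ((hlead i).2 _ (right_ne_zero_of_mul (Ne.symm h0)))
      rw [weightDeg_add] at h1
      exact h (by linarith)
  · rw [hP' m hm]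
    refine Finset.sum_eq_zero fun i _ => Finset.sum_eq_zero fun p hp => ?_
    have hpm : weightDeg w p.1 + weightDeg w p.2 = weightDeg w m := by
      rw [← weightDeg_add, Finset.HasAntidiagonal.mem_antidiagonal.1 hp]
    split_ifs with h
    · rw [hQ' i _ fun h' => hm (by linarith), zero_mul]
    · rw [mul_zero]

theorem isXForm_of_isHomogeneous {f : MixedRing R n} {d : ℕ} (hf : f.IsHomogeneous d) :
    IsXForm d f := by
  intro m hm
  have : MvPolynomial.coeff m.tail f ≠ 0 := fun h => hm (by simp [mixedCoeff, h])
  by_contra h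
  exact this (hf.coeff_eq_zero h)

theorem homogeneousComponent_mem_of_isXHomogeneous {I : Ideal (MixedRing R n)}
    (hI : IsXHomogeneous I) {f : MixedRing R n} (hf : f ∈ I) (d : ℕ) :
    MvPolynomial.homogeneousComponent d f ∈ I := by
  obtain ⟨S, hS, rfl⟩ := hI
  let _ : GradedAlgebra (MvPolynomial.homogeneousSubmodule (Fin n) (PowerSeries R)) :=
    MvPolynomial.gradedAlgebra
  refine MvPolynomial.homogeneousComponent_mem_of_mem (Ideal.homogeneous_span _ _ fun x hx => ?_)
    hf d
  obtain ⟨k, hk⟩ := hS x hx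
  exact ⟨k, hk⟩

theorem mixedCoeff_homogeneousComponent_ne_zero {f : MixedRing R n} {d : ℕ}
    {m : Fin (n + 1) →₀ ℕ} (h : mixedCoeff (MvPolynomial.homogeneousComponent d f) m ≠ 0) :
    mixedCoeff f m ≠ 0 := by
  classical
  rw [mixedCoeff, MvPolynomial.coeff_homogeneousComponent] at h
  split_ifs at h
  · exact h
  · simp at h

/-- If the leading terms of the `g i` generate all leading terms of `x`-forms in `I`, then the
initial forms of the `g i` generate the initial ideal. -/
theorem initialIdeal_eq_span {I : Ideal (MixedRing R n)} (hI : IsXHomogeneous I)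
    {ι : Type*} [Fintype ι] {w : Fin (n + 1) → ℝ} (hw : w 0 < 0)
    {g : ι → MixedRing R n} {e : ι → Fin (n + 1) →₀ ℕ} (hgI : ∀ i, g i ∈ I)
    (hg : ∀ i, IsXForm (xDegree (e i)) (g i)) (hlead : ∀ i, IsLeading w (g i) (e i))
    (hgen : ∀ f ∈ I, ∀ d, IsXForm d f → ∀ m, IsLeading w f m →
      MvPolynomial.monomial m (mixedCoeff f m) ∈ Ideal.span (Set.range fun i =>
        (MvPolynomial.monomial (e i) (mixedCoeff (g i) (e i)) : PolyRing R n))) :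
    initialIdeal w I = Ideal.span (Set.range fun i => initialForm w (g i)) := by
  classical
  refine le_antisymm (Ideal.span_le.2 ?_) (Ideal.span_mono ?_)
  · rintro _ ⟨f, hf, rfl⟩
    rw [SetLike.mem_coe]
    by_cases hne : (initialExponents w f).Nonempty
    · obtain ⟨m₀, hm₀⟩ := hne
      -- The weight is the maximum for f, not for each component, so `P d` may vanish and the `P d`
      -- sum to the initial form of f.
      choose P hP hP' using fun d => exists_weightPart hw (weightDeg w m₀)
        (MvPolynomial.homogeneousComponent d f)
      have hsum : initialForm w f = ∑ d ∈ Finset.range (f.totalDegree + 1), P d := by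
        ext m
        rw [coeff_initialForm w hw, MvPolynomial.coeff_sum]
        by_cases hm : weightDeg w m = weightDeg w m₀
        · rw [Finset.sum_congr rfl fun d _ => hP d m hm, ← mixedCoeff_sum,
            MvPolynomial.sum_homogeneousComponent]
          split_ifs with h
          · rfl
          · by_contra h0
            exact h ⟨fun h => h0 h.symm, fun m' hm' => hm ▸ hm₀.2 m' hm'⟩
        · rw [Finset.sum_eq_zero fun d _ => hP' d m hm, if_neg]
          exact fun h => hm (le_antisymm (hm₀.2 m h.1) (h.2 m₀ hm₀.1))
      rw [hsum]
      refine Ideal.sum_mem _ fun d _ => ?_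
      have hform := isXForm_of_isHomogeneous
        (MvPolynomial.homogeneousComponent_isHomogeneous d f)
      obtain ⟨q, hq, hr, hrem⟩ := exists_division hw hg hlead hform
      have hrI : MvPolynomial.homogeneousComponent d f - ∑ i, q i * g i ∈ I :=
        Ideal.sub_mem _ (homogeneousComponent_mem_of_isXHomogeneous hI hf d)
          (Ideal.sum_mem _ fun i _ => Ideal.mul_mem_left _ _ (hgI i))
      have hr0 : ∀ m, mixedCoeff (MvPolynomial.homogeneousComponent d f - ∑ i, q i * g i) m
          = 0 := by
        -- A nonzero remainder would be an x-form in I whose leading term is, by `hgen`, among the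
        -- excluded ones.
        by_contra! h
        obtain ⟨m, hm⟩ := h
        obtain ⟨k, hk⟩ := exists_isLeading hw hr hm
        exact hrem k hk.1 (hgen _ hrI d hr k hk)
      refine weightPart_mem hw hlead (f := ∑ i, q i * g i) rfl (fun i μ hμ => ?_)
        (fun m hm => ?_) (hP' d)
      · obtain ⟨m, hm, hle⟩ := hq i μ hμ
        exact (weightDeg_le_of_orderKey_le hle).trans
          (hm₀.2 m (mixedCoeff_homogeneousComponent_ne_zero hm))
      · have := hr0 m
        rw [mixedCoeff_sub, sub_eq_zero] at this
        rw [hP d m hm, this]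
    · have h0 : initialForm w f = 0 := by
        ext m
        rw [coeff_initialForm w hw, if_neg fun h => hne ⟨m, h⟩, MvPolynomial.coeff_zero]
      rw [h0]
      exact Ideal.zero_mem _
  · rintro _ ⟨i, rfl⟩
    exact ⟨g i, hgI i, rfl⟩

/-! ### Finitely many initial forms, and the Noetherian induction -/

/-- The exponents of `f` of least degree in `t` among those with the same degrees in `x`. -/
def lowestExponents (f : MixedRing R n) : Set (Fin (n + 1) →₀ ℕ) :=
  {m | mixedCoeff f m ≠ 0 ∧ ∀ m', mixedCoeff f m' ≠ 0 → m'.tail = m.tail → m 0 ≤ m' 0}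

theorem finite_lowestExponents (f : MixedRing R n) : (lowestExponents f).Finite := by
  refine Set.Finite.of_injOn (f := Finsupp.tail) (t := (f.support : Set (Fin n →₀ ℕ))) ?_ ?_
    (Finset.finite_toSet _)
  · intro m hm
    rw [Finset.mem_coe, MvPolynomial.mem_support_iff]
    intro h
    exact hm.1 (by simp [mixedCoeff, h])
  · intro m hm m' hm' h
    rw [← Finsupp.cons_tail m, ← Finsupp.cons_tail m', h,
      le_antisymm (hm.2 m' hm'.1 h.symm) (hm'.2 m hm.1 h)]

/-- For fixed x^α a lower power of t has larger weight, as w 0 < 0. The bounding set is finite and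
independent of w. -/
theorem initialExponents_subset {w : Fin (n + 1) → ℝ} (hw : w 0 < 0) (f : MixedRing R n) :
    initialExponents w f ⊆ lowestExponents f := by
  refine fun m hm => ⟨hm.1, fun m' hm' htail => ?_⟩
  have h1 := hm.2 m' hm'
  have h2 : ∀ i : Fin n, m' i.succ = m i.succ := fun i => by
    rw [← Finsupp.tail_apply, ← Finsupp.tail_apply, htail]
  simp only [weightDeg, Fin.sum_univ_succ, h2, add_le_add_iff_right] at h1
  exact_mod_cast (mul_le_mul_left_of_neg hw).1 h1

theorem IsLeading.mem_lowestExponents {w : Fin (n + 1) → ℝ} (hw : w 0 < 0) {f : MixedRing R n}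
    {e : Fin (n + 1) →₀ ℕ} (he : IsLeading w f e) : e ∈ lowestExponents f :=
  initialExponents_subset hw f ⟨he.1, fun m hm => weightDeg_le_of_orderKey_le (he.2 m hm)⟩

theorem finite_initialForms (f : MixedRing R n) :
    {p | ∃ w : Fin (n + 1) → ℝ, w 0 < 0 ∧ p = initialForm w f}.Finite := by
  refine ((finite_lowestExponents f).finite_subsets.image fun S =>
    (∑ᶠ m ∈ S, MvPolynomial.monomial m (mixedCoeff f m) : PolyRing R n)).subset ?_
  rintro _ ⟨w, hw, rfl⟩
  exact ⟨initialExponents w f, initialExponents_subset hw f, rfl⟩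

/-- The exponents `e i` are fixed and the weight is quantified inside the set, so that one
remainder, found with a single weight, splits all remaining weights into finitely many classes. -/
theorem finite_initialIdeals_of_isLeading [IsNoetherianRing R] {I : Ideal (MixedRing R n)}
    (hI : IsXHomogeneous I) (J : Ideal (PolyRing R n)) :
    ∀ (ι : Type) [Fintype ι] (g : ι → MixedRing R n) (e : ι → Fin (n + 1) →₀ ℕ),
      (∀ i, g i ∈ I) → (∀ i, IsXForm (xDegree (e i)) (g i)) →
      J = Ideal.span (Set.range fun i =>
        (MvPolynomial.monomial (e i) (mixedCoeff (g i) (e i)) : PolyRing R n)) →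
      {K | ∃ w : Fin (n + 1) → ℝ, w 0 < 0 ∧ (∀ i, IsLeading w (g i) (e i)) ∧
        K = initialIdeal w I}.Finite := by
  induction J using WellFoundedGT.induction with
  | _ J ih =>
    intro ι _ g e hgI hg hJ
    by_cases hgen : ∀ w : Fin (n + 1) → ℝ, w 0 < 0 → (∀ i, IsLeading w (g i) (e i)) →
        ∀ f ∈ I, ∀ d, IsXForm d f → ∀ m, IsLeading w f m →
          MvPolynomial.monomial m (mixedCoeff f m) ∈ J
    · refine ((Set.Finite.pi' fun i => finite_initialForms (g i)).image fun p =>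
        Ideal.span (Set.range p)).subset ?_
      rintro _ ⟨w, hw, hlead, rfl⟩
      exact ⟨fun i => initialForm w (g i), fun i => ⟨w, hw, rfl⟩,
        (initialIdeal_eq_span hI hw hgI hg hlead (hJ ▸ hgen w hw hlead)).symm⟩
    · push Not at hgen
      obtain ⟨w, hw, hlead, f, hfI, d, hf, m, hm, hmJ⟩ := hgen
      obtain ⟨q, hq, hr, hrem⟩ := exists_division hw hg hlead hf
      set r := f - ∑ i, q i * g i with hrdef
      have hrI : r ∈ I := Ideal.sub_mem _ hfI
        (Ideal.sum_mem _ fun i _ => Ideal.mul_mem_left _ _ (hgI i))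
      obtain ⟨m₁, hm₁⟩ : ∃ m₁, mixedCoeff r m₁ ≠ 0 := by
        by_contra! h
        have hr0 : r = 0 := by
          refine MvPolynomial.ext _ _ fun α => PowerSeries.ext fun b => ?_
          simpa [mixedCoeff] using h (Finsupp.cons b α)
        -- If r = 0, the quotients form a standard representation of f, forcing its leading term
        -- into J.
        exact hmJ (hJ ▸ leadingTerm_mem hlead hm (sub_eq_zero.1 (hrdef.symm.trans hr0)) hq)
      have hstep : ∀ k ∈ lowestExponents r, {K | ∃ w : Fin (n + 1) → ℝ, w 0 < 0 ∧
          (∀ i : Option ι, IsLeading w (i.elim r g) (i.elim k e)) ∧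
            K = initialIdeal w I}.Finite := by
        intro k hk
        refine ih _ ?_ (Option ι) (fun i => i.elim r g) (fun i => i.elim k e) ?_ ?_ rfl
        · rw [SetLike.lt_iff_le_and_exists]
          refine ⟨?_, MvPolynomial.monomial k (mixedCoeff r k), Ideal.subset_span ⟨none, rfl⟩,
            hJ ▸ hrem k hk.1⟩
          rw [hJ]
          refine Ideal.span_mono ?_
          rintro _ ⟨i, rfl⟩
          exact ⟨some i, rfl⟩
        · rintro (_ | i)
          · exact hrI
          · exact hgI i
        · rintro (_ | i)
          · simpa [hr k hk.1] using hr
          · exact hg i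
      refine ((finite_lowestExponents r).biUnion hstep).subset ?_
      rintro _ ⟨v, hv, hvlead, rfl⟩
      obtain ⟨k, hk⟩ := exists_isLeading hv hr hm₁
      refine Set.mem_biUnion (hk.mem_lowestExponents hv) ⟨v, hv, ?_, rfl⟩
      rintro (_ | i)
      · exact hk
      · exact hvlead i

theorem finite_initialIdeals [IsNoetherianRing R] {I : Ideal (MixedRing R n)}
    (hI : IsXHomogeneous I) :
    {J | ∃ w : Fin (n + 1) → ℝ, w 0 < 0 ∧ J = initialIdeal w I}.Finite := by
  -- The empty family imposes no condition on w; the induction starts at J = 0.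
  refine (finite_initialIdeals_of_isLeading hI _ Empty Empty.elim Empty.elim
    (fun i => i.elim) (fun i => i.elim) rfl).subset ?_
  rintro J ⟨w, hw, hJ⟩
  exact ⟨w, hw, fun i => i.elim, hJ⟩

theorem finite_groebnerFan [IsNoetherianRing R] {I : Ideal (MixedRing R n)}
    (hI : IsXHomogeneous I) : (groebnerFan I).Finite := by
  have hcone : {C | ∃ w : Fin (n + 1) → ℝ, w 0 < 0 ∧ C = interiorCone I w}.Finite := by
    refine ((finite_initialIdeals hI).image fun J =>
      closure {v : Fin (n + 1) → ℝ | v 0 < 0 ∧ initialIdeal v I = J}).subset ?_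
    rintro _ ⟨w, hw, rfl⟩
    exact ⟨initialIdeal w I, ⟨w, hw, rfl⟩, rfl⟩
  refine hcone.union ((hcone.image fun C => C ∩ {v | v 0 = 0}).subset ?_)
  rintro _ ⟨w, hw, rfl⟩
  exact ⟨interiorCone I w, ⟨w, hw, rfl⟩, rfl⟩

end GroebnerFan

end

theorem corollary3p11 {R : Type*} [CommRing R] [IsNoetherianRing R] (n : ℕ)
    (I : Ideal (GroebnerFan.MixedRing R n)) (hI : GroebnerFan.IsXHomogeneous I) :
    {J : Ideal (GroebnerFan.PolyRing R n) |
        ∃ w : Fin (n + 1) → ℝ, w 0 < 0 ∧ J = GroebnerFan.initialIdeal w I}.Finite ∧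
      (GroebnerFan.groebnerFan I).Finite :=
  ⟨GroebnerFan.finite_initialIdeals hI, GroebnerFan.finite_groebnerFan hI⟩
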